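/- Let $d\ge 1$, $R>0$, let $|\cdot|$ be the Euclidean norm on $\mathbb{R}^d$, $B(z,\rho)=\{x\in\mathbb{R}^d:|x-z|<\rho\}$ and $S^{d-1}=\{x\in\mathbb{R}^d:|x|=1\}$. For $\mathcal{K}\subset S^{d-1}$ put $$C_{\mathcal{K}}=\bigcap_{v\in\mathcal{K}}\big(\mathbb{R}^d\setminus B(Rv,R)\big),$$ and call $\mathcal{K}$ spherically convex if $\mathrm{co}(K)\cap S^{d-1}=\mathcal{K}$, where $K=\{\lambda v: v\in\mathcal{K},\ \lambda\ge 0\}$ and $\mathrm{co}$ is the convex hull. For a nonempty closed set $A\subset\mathbb{R}^d$ and $q\in A$ let $$\mathrm{Tan}(A,q)=\{v\in\mathbb{R}^d:\ \forall \varepsilon>0\ \exists x\in A\cap B(q,\varepsilon)\ \exists r>0,\ |r(x-q)-v|<\varepsilon\},$$ $$\mathrm{Nor}(A,q)=\{u\in\mathbb{R}^d:\ \langle u,v\rangle\le 0\ \ \forall v\in\mathrm{Tan}(A,q)\},$$ let $\mathrm{Unp}(A)$ be the set of points of $\mathbb{R}^d$ that have a unique nearest point in $A$, and let $$\mathrm{reach}(A)=\inf_{a\in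 A}\ \sup\{\rho>0: B(a,\rho)\subset \mathrm{Unp}(A)\}\in[0,\infty],$$ where $\sup\emptyset=0$. Let $\mathcal{K}$ be a nonempty closed subset of $S^{d-1}$ that is contained in a closed hemisphere $\{v\in S^{d-1}:\langle u,v\rangle\ge 0\}$, for some $u\in S^{d-1}$, and let $\mathcal{N}=\mathrm{Nor}(C_{\mathcal{K}},o)\cap S^{d-1}$, where $o$ is the origin. Then the following properties are equivalent: a) $\mathcal{K}$ is spherically convex; b) $\mathrm{reach}(C_{\mathcal{K}})\ge R$; c) $C_{\mathcal{K}}=C_{\mathcal{N}}$. -/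

import Mathlib

open scoped ENNReal

namespace RBody

noncomputable section

variable {d : ℕ}

/-- The tangent cone (in the sense of Federer) of `A` at `q`. -/
def Tan (A : Set (EuclideanSpace ℝ (Fin d))) (q : EuclideanSpace ℝ (Fin d)) :
    Set (EuclideanSpace ℝ (Fin d)) :=
  {v | ∀ ε : ℝ, 0 < ε → ∃ x ∈ A ∩ Metric.ball q ε, ∃ r : ℝ, 0 < r ∧ ‖r • (x - q) - v‖ < ε}

/-- The normal cone of `A` at `q`. -/
def Nor (A : Set (EuclideanSpace ℝ (Fin d))) (q : EuclideanSpace ℝ (Fin d)) :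
    Set (EuclideanSpace ℝ (Fin d)) :=
  {u | ∀ v ∈ Tan A q, inner ℝ u v ≤ 0}

/-- The points with a unique nearest point in `A`. -/
def Unp (A : Set (EuclideanSpace ℝ (Fin d))) : Set (EuclideanSpace ℝ (Fin d)) :=
  {x | ∃! b, b ∈ A ∧ dist x b = Metric.infDist x A}

/-- `reach(A, a)`, the supremum of all `ρ > 0` with `B(a, ρ) ⊆ Unp(A)`; it is `0` if there is no
such `ρ`, and `∞` if `ρ` may be arbitrarily large. -/
def reachAt (A : Set (EuclideanSpace ℝ (Fin d))) (a : EuclideanSpace ℝ (Fin d)) : ℝ≥0∞ :=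
  sSup {t | ∃ ρ : ℝ, 0 < ρ ∧ Metric.ball a ρ ⊆ Unp A ∧ t = ENNReal.ofReal ρ}

/-- `reach(A)`, the infimum of `reach(A, a)` over `a ∈ A`. -/
def reach (A : Set (EuclideanSpace ℝ (Fin d))) : ℝ≥0∞ :=
  ⨅ a ∈ A, reachAt A a

/-- The cone `{λ v : v ∈ 𝒦, λ ≥ 0}` related to a subset `𝒦` of the unit sphere. -/
def relatedCone (𝒦 : Set (EuclideanSpace ℝ (Fin d))) : Set (EuclideanSpace ℝ (Fin d)) :=
  {x | ∃ v ∈ 𝒦, ∃ c : ℝ, 0 ≤ c ∧ x = c • v}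

/-- The spherical convex hull of a subset of the unit sphere. -/
def sphHull (𝒦 : Set (EuclideanSpace ℝ (Fin d))) : Set (EuclideanSpace ℝ (Fin d)) :=
  convexHull ℝ (relatedCone 𝒦) ∩ Metric.sphere 0 1

/-- A subset of the unit sphere is spherically convex if it is its own spherical convex hull. -/
def SphConvex (𝒦 : Set (EuclideanSpace ℝ (Fin d))) : Prop :=
  sphHull 𝒦 = 𝒦

/-- The `R`-cone with vertex at the origin determined by `𝒦`. -/
def RCone (R : ℝ) (𝒦 : Set (EuclideanSpace ℝ (Fin d))) : Set (EuclideanSpace ℝ (Fin d)) :=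
  ⋂ v ∈ 𝒦, (Metric.ball (R • v) R)ᶜ

/-- The unit normal directions of `A` at `q`. -/
def unitNor (A : Set (EuclideanSpace ℝ (Fin d))) (q : EuclideanSpace ℝ (Fin d)) :
    Set (EuclideanSpace ℝ (Fin d)) :=
  Nor A q ∩ Metric.sphere 0 1

/-- The closed hemisphere of the unit sphere with pole `u`. -/
def hemisphere (u : EuclideanSpace ℝ (Fin d)) : Set (EuclideanSpace ℝ (Fin d)) :=
  {v | v ∈ Metric.sphere (0 : EuclideanSpace ℝ (Fin d)) 1 ∧ 0 ≤ inner ℝ u v}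

end

end RBody

/-!
The vectors of the convex cone generated by `𝒦` are proximal normals of the `R`-cone `C` of `𝒦` at
the origin: in each of these directions some ball touches `C` at the origin from outside. If the
reach of `C` is at least `R`, an argument of Federer inflates these touching balls to radius `R`, so
the balls given by the spherical convex hull of `𝒦` miss `C` as well. Since a closed set of
directions can be recovered from its `R`-cone, the hull then adds nothing to `𝒦`. The unit normals
contain the hull, so equality of `C` with their `R`-cone forces the same conclusion.

Conversely, let `𝒦` be spherically convex. By the bipolar theorem its elements are the only unit
normals of `C` at the origin. A point `y` outside `C` has a projection onto the cone generated by
`𝒦`, with direction `v` say. Then `y` lies in `B(Rv, R)`, and its radial projection from `Rv` to the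
boundary of that ball belongs to `C`, hence is the unique nearest point of `y`; only `y = Rv` is
excluded, whose distance to `C` is at least `R`.
-/

namespace RBody

open Filter Metric Topology
open ProperCone (innerDual)
open scoped InnerProductSpace

section ConvexCones

variable {E : Type*} [NormedAddCommGroup E]

lemma inv_norm_smul_mem_sphere [NormedSpace ℝ E] {x : E} (hx : x ≠ 0) :
    ‖x‖⁻¹ • x ∈ sphere (0 : E) 1 := by
  rw [mem_sphere_zero_iff_norm, norm_smul, norm_inv, norm_norm,
    inv_mul_cancel₀ (norm_ne_zero_iff.2 hx)]

lemma mem_closure_inter_sphere_of_mem_closure [NormedSpace ℝ E] (C : PointedCone ℝ E) {x : E}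
    (hx : x ∈ closure (C : Set E)) (hx1 : ‖x‖ = 1) :
    x ∈ closure ((C : Set E) ∩ sphere 0 1) := by
  have hx0 : x ≠ 0 := norm_ne_zero_iff.1 (by rw [hx1]; exact one_ne_zero)
  have hnormalize : Tendsto (fun y : E => ‖y‖⁻¹ • y) (𝓝 x) (𝓝 x) := by
    simpa [hx1] using
      (continuousAt_id.norm.inv₀ (norm_ne_zero_iff.2 hx0)).tendsto.smul continuousAt_id.tendsto
  refine mem_closure_of_frequently_of_tendsto ?_ hnormalize
  refine ((mem_closure_iff_frequently.1 hx).and_eventually (eventually_ne_nhds hx0)).mono ?_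
  rintro y ⟨hyC, hy0⟩
  exact ⟨C.smul_mem (by positivity) hyC, inv_norm_smul_mem_sphere hy0⟩

variable [InnerProductSpace ℝ E] [CompleteSpace E]

lemma coe_innerDual_innerDual (s : Set E) :
    (innerDual (innerDual s : Set E) : Set E) = closure (PointedCone.hull ℝ s) := by
  let C : ProperCone ℝ E := Submodule.closure (PointedCone.hull ℝ s)
  have hsC : s ⊆ C := PointedCone.subset_hull.trans subset_closure
  have hdual : innerDual s = innerDual (C : Set E) := by
    refine le_antisymm (fun y hy => ?_) (ProperCone.innerDual_le_innerDual hsC)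
    have hsy : s ⊆ innerDual {y} := fun x hx => by
      simpa [real_inner_comm] using hy hx
    have hCy : C ≤ innerDual {y} := Submodule.closure_le.2 (Submodule.span_le.2 hsy)
    intro x hx
    simpa [real_inner_comm] using hCy hx
  rw [hdual, C.innerDual_innerDual]
  rfl

lemma exists_moreau_decomposition (C : ProperCone ℝ E) (y : E) :
    ∃ p ∈ C, ⟪y - p, p⟫_ℝ = 0 ∧ ∀ w ∈ C, ⟪y - p, w⟫_ℝ ≤ 0 := by
  obtain ⟨p, hp, hmin⟩ := exists_norm_eq_iInf_of_complete_convex C.nonempty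
    C.isClosed.isComplete C.convex y
  have hvar : ∀ w ∈ C, ⟪y - p, w - p⟫_ℝ ≤ 0 :=
    (norm_eq_iInf_iff_real_inner_le_zero C.convex hp).1 hmin
  have horth : ⟪y - p, p⟫_ℝ = 0 := by
    have h0 := hvar 0 C.toSubmodule.zero_mem
    have h2 := hvar (p + p) (C.toSubmodule.add_mem hp hp)
    rw [zero_sub, inner_neg_right] at h0
    rw [add_sub_cancel_right] at h2
    linarith
  refine ⟨p, hp, horth, fun w hw => ?_⟩
  simpa [inner_sub_right, horth] using hvar w hw

end ConvexCones

section TouchingBalls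

variable {E : Type*} [NormedAddCommGroup E] [InnerProductSpace ℝ E]

lemma dist_add_smul_sq (x q : E) {v : E} (hv : ‖v‖ = 1) (R : ℝ) :
    dist x (q + R • v) ^ 2 = ‖x - q‖ ^ 2 - 2 * R * ⟪v, x - q⟫_ℝ + R ^ 2 := by
  rw [dist_eq_norm, ← sub_sub, norm_sub_sq_real, real_inner_smul_right, norm_smul, hv,
    Real.norm_eq_abs, mul_one, sq_abs, real_inner_comm]
  ring

lemma le_dist_add_smul_iff {x q v : E} (hv : ‖v‖ = 1) {R : ℝ} (hR : 0 ≤ R) :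
    R ≤ dist x (q + R • v) ↔ 2 * R * ⟪v, x - q⟫_ℝ ≤ ‖x - q‖ ^ 2 := by
  rw [← sq_le_sq₀ hR dist_nonneg, dist_add_smul_sq x q hv]
  constructor <;> intro h <;> linarith

lemma dist_add_smul_le_iff {x q v : E} (hv : ‖v‖ = 1) {R : ℝ} (hR : 0 ≤ R) :
    dist x (q + R • v) ≤ R ↔ ‖x - q‖ ^ 2 ≤ 2 * R * ⟪v, x - q⟫_ℝ := by
  rw [← sq_le_sq₀ dist_nonneg hR, dist_add_smul_sq x q hv]
  constructor <;> intro h <;> linarith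

lemma add_mul_lt_dist_add_smul {x q v : E} (hv : ‖v‖ = 1) {δ k h : ℝ} (hδ : 0 ≤ δ) (hk : 0 ≤ k)
    (hk1 : k ≤ 1) (hh : 0 < h) (hx : δ ≤ dist x q) (hinner : ⟪v, x - q⟫_ℝ < -(k * δ)) :
    δ + k * h < dist x (q + h • v) := by
  rw [dist_eq_norm] at hx
  refine lt_of_pow_lt_pow_left₀ 2 dist_nonneg ?_
  rw [dist_add_smul_sq x q hv]
  calc (δ + k * h) ^ 2 = δ ^ 2 + 2 * h * (k * δ) + k ^ 2 * h ^ 2 := by ring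
    _ ≤ ‖x - q‖ ^ 2 + 2 * h * (k * δ) + 1 * h ^ 2 := by
      gcongr
      exact pow_le_one₀ hk hk1
    _ < ‖x - q‖ ^ 2 - 2 * h * ⟪v, x - q⟫_ℝ + h ^ 2 := by
      linarith [mul_lt_mul_of_pos_left hinner hh]

/-- The cone of proximal normals of `A` at `q`: the vectors `v` whose inner product with `x - q` is
at most quadratic in `‖x - q‖` for `x ∈ A`, or, equivalently, that are multiples of directions in
which some ball touches `A` at `q` from outside. -/
def proxNormalCone (A : Set E) (q : E) : PointedCone ℝ E where
  carrier := {v | ∃ M : ℝ, ∀ x ∈ A, ⟪v, x - q⟫_ℝ ≤ M * ‖x - q‖ ^ 2}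
  zero_mem' := ⟨0, fun x _ => by simp⟩
  add_mem' := by
    rintro v w ⟨M, hM⟩ ⟨N, hN⟩
    refine ⟨M + N, fun x hx => ?_⟩
    rw [inner_add_left, add_mul]
    exact add_le_add (hM x hx) (hN x hx)
  smul_mem' := by
    rintro ⟨c, hc⟩ v ⟨M, hM⟩
    refine ⟨c * M, fun x hx => ?_⟩
    rw [Nonneg.mk_smul, real_inner_smul_left, mul_assoc]
    exact mul_le_mul_of_nonneg_left (hM x hx) hc

lemma mem_proxNormalCone_of_le_dist {A : Set E} {q v : E} (hv : ‖v‖ = 1) {R : ℝ} (hR : 0 < R)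
    (h : ∀ x ∈ A, R ≤ dist x (q + R • v)) : v ∈ proxNormalCone A q := by
  refine ⟨(2 * R)⁻¹, fun x hx => ?_⟩
  rw [le_inv_mul_iff₀ (by positivity)]
  exact (le_dist_add_smul_iff hv hR.le).1 (h x hx)

lemma exists_pos_forall_le_dist_of_mem_proxNormalCone {A : Set E} {q v : E} (hv : ‖v‖ = 1)
    (h : v ∈ proxNormalCone A q) {R : ℝ} (hR : 0 < R) :
    ∃ τ ∈ Set.Ioo 0 R, ∀ x ∈ A, τ ≤ dist x (q + τ • v) := by
  obtain ⟨M, hM⟩ := h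
  have hsmall : ∀ᶠ τ : ℝ in 𝓝[>] 0, 2 * τ * M < 1 := by
    have hcont : Continuous fun τ : ℝ => 2 * τ * M := by fun_prop
    exact nhdsWithin_le_nhds (hcont.tendsto 0 |>.eventually_lt_const (by simp))
  obtain ⟨τ, hτM, hτ⟩ := (hsmall.and (Ioo_mem_nhdsGT hR)).exists
  refine ⟨τ, hτ, fun x hx => (le_dist_add_smul_iff hv hτ.1.le).2 ?_⟩
  calc 2 * τ * ⟪v, x - q⟫_ℝ ≤ 2 * τ * (M * ‖x - q‖ ^ 2) :=
        mul_le_mul_of_nonneg_left (hM x hx) (by linarith [hτ.1])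
    _ = (2 * τ * M) * ‖x - q‖ ^ 2 := by ring
    _ ≤ ‖x - q‖ ^ 2 := mul_le_of_le_one_left (sq_nonneg _) hτM.le

end TouchingBalls

section NearestPoints

section ProperMetricSpace

variable {X : Type*} [PseudoMetricSpace X] [ProperSpace X]

lemma eventually_forall_nearest_dist_lt {A : Set X} (hA : IsClosed A) {y p : X}
    (huniq : ∀ b ∈ A, dist y b = infDist y A → b = p) {ε : ℝ} (hε : 0 < ε) :
    ∀ᶠ x in 𝓝 y, ∀ b ∈ A, dist x b = infDist x A → dist b p < ε := by
  rcases (A \ ball p ε).eq_empty_or_nonempty with hfar | hfar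
  · exact Eventually.of_forall fun x b hb _ => Set.sdiff_eq_empty.1 hfar hb
  have hgap : infDist y A < infDist y (A \ ball p ε) := by
    obtain ⟨b, hb, hbdist⟩ := (hA.sdiff isOpen_ball).exists_infDist_eq_dist hfar y
    refine (infDist_le_infDist_of_subset Set.sdiff_subset hfar).lt_of_ne fun heq => ?_
    obtain rfl := huniq b hb.1 (hbdist.symm.trans heq.symm)
    exact hb.2 (mem_ball_self hε)
  filter_upwards [(continuous_infDist_pt A).continuousAt.eventually_lt
    (continuous_infDist_pt _).continuousAt hgap] with x hx b hb hbdist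
  by_contra hbp
  have hbfar : b ∈ A \ ball p ε := ⟨hb, hbp⟩
  exact (infDist_le_dist_of_mem hbfar).not_gt (hbdist.trans_lt hx)

lemma exists_mem_closedBall_add_mul_le_of_frequently_lt {f : X → ℝ} (hf : Continuous f) {k : ℝ}
    (hk : 0 ≤ k) {x : X} {s : ℝ} (hs : 0 ≤ s)
    (hslope : ∀ y ∈ ball x s, f x ≤ f y → ∃ᶠ z in 𝓝 y, f y + k * dist y z < f z) :
    ∃ y ∈ closedBall x s, f x + k * s ≤ f y := by
  have hcont : Continuous fun y => f y - k * dist y x := by fun_prop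
  obtain ⟨y, hy, hmax⟩ := (isCompact_closedBall x s).exists_isMaxOn
    (nonempty_closedBall.2 hs) hcont.continuousOn
  have hfy : f x + k * dist y x ≤ f y := by
    have := hmax (mem_closedBall_self hs)
    simp only [Set.mem_ofPred_eq, dist_self, mul_zero, sub_zero] at this
    linarith
  refine ⟨y, hy, ?_⟩
  rcases (mem_closedBall.1 hy).eq_or_lt with hys | hys
  · rwa [hys] at hfy
  have hfxy : f x ≤ f y := by linarith [mul_nonneg hk (dist_nonneg (x := y) (y := x))]
  obtain ⟨z, hz, hzs⟩ :=
    ((hslope y hys hfxy).and_eventually (isOpen_ball.mem_nhds hys)).exists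
  have hgz : f z - k * dist z x ≤ f y - k * dist y x := hmax (ball_subset_closedBall hzs)
  have htri : k * dist z x ≤ k * dist y z + k * dist y x := by
    rw [← mul_add, dist_comm y z]
    exact mul_le_mul_of_nonneg_left (dist_triangle z y x) hk
  linarith

end ProperMetricSpace

lemma existsUnique_nearest_of_wbtw {E : Type*} [NormedAddCommGroup E] [NormedSpace ℝ E]
    [StrictConvexSpace ℝ E] {A : Set E} {c y q : E} (hA : ∀ b ∈ A, dist c q ≤ dist c b)
    (hq : q ∈ A) (hy : Wbtw ℝ c y q) (hyc : y ≠ c) :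
    ∃! b, b ∈ A ∧ dist y b = infDist y A := by
  have hle : ∀ b ∈ A, dist y q ≤ dist y b := fun b hb => by
    linarith [hy.dist_add_dist, hA b hb, dist_triangle c y b]
  have hinf : infDist y A = dist y q :=
    le_antisymm (infDist_le_dist_of_mem hq) ((le_infDist ⟨q, hq⟩).2 hle)
  refine ⟨q, ⟨hq, hinf.symm⟩, fun b ⟨hb, hbdist⟩ => ?_⟩
  rw [hinf] at hbdist
  have hcb : dist c y + dist y b = dist c b :=
    le_antisymm (by linarith [hy.dist_add_dist, hA b hb]) (dist_triangle c y b)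
  have hray : SameRay ℝ (b - c) (q - c) := by
    refine SameRay.trans (dist_add_dist_eq_iff.1 hcb).sameRay_vsub_left.symm
      hy.sameRay_vsub_left fun h => absurd h (sub_ne_zero.2 hyc)
  have hnorm : ‖b - c‖ = ‖q - c‖ := by
    rw [← dist_eq_norm', ← dist_eq_norm', ← hcb, hbdist, hy.dist_add_dist]
  exact sub_left_injective (hray.norm_eq_iff.1 hnorm)

variable {E : Type*} [NormedAddCommGroup E] [InnerProductSpace ℝ E] [ProperSpace E] {A : Set E}

-- The points `z` lie on the ray from the nearest point through `y`, along which the distance to `A`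
-- grows at rate `1`.
lemma frequently_infDist_add_mul_dist_lt (hA : IsClosed A) {y : E}
    (hy : ∃! b, b ∈ A ∧ dist y b = infDist y A) (hpos : 0 < infDist y A) {k : ℝ} (hk : 0 ≤ k)
    (hk1 : k < 1) : ∃ᶠ z in 𝓝 y, infDist y A + k * dist y z < infDist z A := by
  obtain ⟨p, ⟨hpA, hpdist⟩, huniq⟩ := hy
  set δ := infDist y A
  set u : E := δ⁻¹ • (y - p) with hu
  have hyp : ‖y - p‖ = δ := by rw [← dist_eq_norm, hpdist]
  have hu1 : ‖u‖ = 1 := by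
    rw [hu, norm_smul, hyp, norm_inv, Real.norm_of_nonneg hpos.le, inv_mul_cancel₀ hpos.ne']
  have hinner : ∀ b, ⟪u, b - y⟫_ℝ ≤ dist b p - δ := fun b => by
    have huy : ⟪u, y - p⟫_ℝ = δ := by
      rw [hu, real_inner_smul_left, real_inner_self_eq_norm_sq, hyp, sq,
        inv_mul_cancel_left₀ hpos.ne']
    have hub : ⟪u, b - p⟫_ℝ ≤ dist b p := by
      simpa [hu1, dist_eq_norm] using real_inner_le_norm u (b - p)
    rw [← sub_sub_sub_cancel_right b y p, inner_sub_right, huy]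
    exact sub_le_sub_right hub δ
  have hray : Tendsto (fun h : ℝ => y + h • u) (𝓝[>] 0) (𝓝 y) := by
    have hcont : Continuous fun h : ℝ => y + h • u := by fun_prop
    simpa using (hcont.tendsto 0).mono_left nhdsWithin_le_nhds
  have hnear := hray.eventually <| eventually_forall_nearest_dist_lt hA (p := p)
    (fun b hb hbdist => huniq b ⟨hb, hbdist⟩) (mul_pos (sub_pos.2 hk1) hpos)
  refine hray.frequently (Eventually.frequently ?_)
  filter_upwards [hnear, self_mem_nhdsWithin] with h hclose (hh : 0 < h)
  obtain ⟨b, hb, hbdist⟩ := hA.exists_infDist_eq_dist ⟨p, hpA⟩ (y + h • u)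
  have hub : ⟪u, b - y⟫_ℝ < -(k * δ) := by linarith [hinner b, hclose b hb hbdist.symm]
  rw [dist_self_add_right, norm_smul, hu1, mul_one, Real.norm_of_nonneg hh.le, hbdist, dist_comm]
  exact add_mul_lt_dist_add_smul hu1 hpos.le hk hk1.le hh
    (dist_comm y b ▸ infDist_le_dist_of_mem hb) hub

lemma exists_mem_closedBall_infDist_add_le (hA : IsClosed A) {x : E} (hpos : 0 < infDist x A)
    {s : ℝ} (hs : 0 ≤ s) (huniq : ∀ y ∈ ball x s, ∃! b, b ∈ A ∧ dist y b = infDist y A) :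
    ∃ y ∈ closedBall x s, infDist x A + s ≤ infDist y A := by
  obtain ⟨m, hm, hmax⟩ := (isCompact_closedBall x s).exists_isMaxOn
    (nonempty_closedBall.2 hs) (continuous_infDist_pt A).continuousOn
  refine ⟨m, hm, ?_⟩
  have hslope : ∀ k ∈ Set.Ico (0 : ℝ) 1, infDist x A + k * s ≤ infDist m A := fun k hk => by
    obtain ⟨y, hy, hxy⟩ := exists_mem_closedBall_add_mul_le_of_frequently_lt
      (continuous_infDist_pt A) hk.1 hs fun y hy hxy =>
        frequently_infDist_add_mul_dist_lt hA (huniq y hy) (hpos.trans_le hxy) hk.1 hk.2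
    exact hxy.trans (hmax hy)
  have hlim : Tendsto (fun k => infDist x A + k * s) (𝓝[<] 1) (𝓝 (infDist x A + s)) := by
    have hcont : Continuous fun k => infDist x A + k * s := by fun_prop
    simpa using (hcont.tendsto 1).mono_left nhdsWithin_le_nhds
  exact le_of_tendsto hlim (mem_of_superset (Ico_mem_nhdsLT zero_lt_one) hslope)

lemma le_infDist_add_smul_of_existsUnique_nearest (hA : IsClosed A) {a w : E} (ha : a ∈ A)
    (hw : ‖w‖ = 1) {τ t : ℝ} (hτ : 0 < τ) (hτt : τ ≤ t) (hdist : τ ≤ infDist (a + τ • w) A)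
    (huniq : ∀ y ∈ ball (a + τ • w) (t - τ), ∃! b, b ∈ A ∧ dist y b = infDist y A) :
    t ≤ infDist (a + t • w) A := by
  obtain ⟨y, hy, hty⟩ := exists_mem_closedBall_infDist_add_le hA (hτ.trans_le hdist)
    (sub_nonneg.2 hτt) huniq
  rw [mem_closedBall] at hy
  have hτw : dist (a + τ • w) a = τ := by
    rw [dist_self_add_left, norm_smul, hw, mul_one, Real.norm_of_nonneg hτ.le]
  have hya : ‖y - a‖ = t := by
    rw [← dist_eq_norm]
    exact le_antisymm (by linarith [dist_triangle y (a + τ • w) a])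
      (by linarith [infDist_le_dist_of_mem (x := y) ha])
  have hinner : t ≤ ⟪w, y - a⟫_ℝ := by
    have := pow_le_pow_left₀ dist_nonneg hy 2
    rw [dist_add_smul_sq y a hw, hya] at this
    nlinarith
  have hyt : y = a + t • w := by
    rw [← dist_eq_zero, ← sq_nonpos_iff, dist_add_smul_sq y a hw, hya]
    nlinarith
  rw [← hyt]
  linarith

-- Below the reach, a small ball touching `A` at `a` can be inflated without changing its direction.
lemma le_dist_add_smul_of_mem_proxNormalCone (hA : IsClosed A) {a w : E} (ha : a ∈ A)
    (hw : ‖w‖ = 1) (hwN : w ∈ proxNormalCone A a) {R : ℝ} (hR : 0 < R)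
    (huniq : ∀ y ∈ ball a R, ∃! b, b ∈ A ∧ dist y b = infDist y A) {x : E} (hx : x ∈ A) :
    R ≤ dist x (a + R • w) := by
  obtain ⟨τ, ⟨hτ, hτR⟩, htouch⟩ := exists_pos_forall_le_dist_of_mem_proxNormalCone hw hwN hR
  have hdist : τ ≤ infDist (a + τ • w) A :=
    (le_infDist ⟨a, ha⟩).2 fun b hb => dist_comm b _ ▸ htouch b hb
  have hgrow : ∀ t ∈ Set.Ico τ R, t ≤ dist x (a + t • w) := fun t ht => by
    have hball : ball (a + τ • w) (t - τ) ⊆ ball a R := ball_subset_ball' <| by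
      rw [dist_self_add_left, norm_smul, hw, mul_one, Real.norm_of_nonneg hτ.le]
      linarith [ht.2]
    rw [dist_comm]
    exact (le_infDist_add_smul_of_existsUnique_nearest hA ha hw hτ ht.1 hdist
      fun y hy => huniq y (hball hy)).trans (infDist_le_dist_of_mem hx)
  have hcont : Continuous fun t : ℝ => dist x (a + t • w) := by fun_prop
  exact le_of_tendsto_of_tendsto (tendsto_id.mono_left nhdsWithin_le_nhds)
    ((hcont.tendsto R).mono_left nhdsWithin_le_nhds)
    (mem_of_superset (Ico_mem_nhdsLT hτR) hgrow)

end NearestPoints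

variable {d : ℕ}

section Reach

variable {A : Set (EuclideanSpace ℝ (Fin d))} {R : ℝ}

lemma ball_subset_Unp_of_le_reach (h : ENNReal.ofReal R ≤ reach A)
    {a : EuclideanSpace ℝ (Fin d)} (ha : a ∈ A) : ball a R ⊆ Unp A := by
  intro x (hx : dist x a < R)
  have hlt : ENNReal.ofReal (dist x a) < reachAt A a :=
    ((ENNReal.ofReal_lt_ofReal_iff (dist_nonneg.trans_lt hx)).2 hx).trans_le
      (h.trans (iInf₂_le a ha))
  obtain ⟨_, ⟨ρ, hρ, hsub, rfl⟩, hlt⟩ := lt_sSup_iff.1 hlt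
  exact hsub ((ENNReal.ofReal_lt_ofReal_iff hρ).1 hlt)

lemma le_reach_of_forall_infDist_lt (hR : 0 < R)
    (h : ∀ y, infDist y A < R → y ∈ Unp A) : ENNReal.ofReal R ≤ reach A :=
  le_iInf₂ fun _ ha => le_sSup
    ⟨R, hR, fun y hy => h y ((infDist_le_dist_of_mem ha).trans_lt hy), rfl⟩

end Reach

section NormalCones

variable {A : Set (EuclideanSpace ℝ (Fin d))} {q : EuclideanSpace ℝ (Fin d)}

lemma mem_Tan_of_forall_add_smul_mem {w : EuclideanSpace ℝ (Fin d)}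
    (h : ∀ t : ℝ, 0 < t → q + t • w ∈ A) : w ∈ Tan A q := by
  intro ε hε
  obtain ⟨t, ht, htw⟩ : ∃ t : ℝ, 0 < t ∧ q + t • w ∈ ball q ε := by
    have hcont : Continuous fun t : ℝ => q + t • w := by fun_prop
    have hball : ∀ᶠ t : ℝ in 𝓝[>] 0, q + t • w ∈ ball q ε := nhdsWithin_le_nhds <|
      (hcont.tendsto 0).eventually (isOpen_ball.mem_nhds (by simpa using hε))
    exact (eventually_mem_nhdsWithin.and hball).exists
  refine ⟨q + t • w, ⟨h t ht, htw⟩, t⁻¹, inv_pos.2 ht, ?_⟩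
  rwa [add_sub_cancel_left, inv_smul_smul₀ ht.ne', sub_self, norm_zero]

lemma proxNormalCone_subset_Nor : (proxNormalCone A q : Set _) ⊆ Nor A q := by
  rintro v ⟨M, hM⟩ w hw
  have hbound : ∀ ε > 0, ⟪v, w⟫_ℝ ≤ |M| * ((‖w‖ + ε) * ε) + ‖v‖ * ε := by
    intro ε hε
    obtain ⟨x, ⟨hxA, hxε⟩, r, hr, hlt⟩ := hw ε hε
    rw [mem_ball, dist_eq_norm] at hxε
    have hrx : r * ‖x - q‖ ≤ ‖w‖ + ε := by
      rw [← Real.norm_of_nonneg hr.le, ← norm_smul]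
      linarith [norm_le_norm_add_norm_sub' (r • (x - q)) w]
    calc ⟪v, w⟫_ℝ = r * ⟪v, x - q⟫_ℝ + ⟪v, w - r • (x - q)⟫_ℝ := by
          rw [inner_sub_right v w, real_inner_smul_right, add_sub_cancel]
      _ ≤ r * (|M| * ‖x - q‖ ^ 2) + ‖v‖ * ‖w - r • (x - q)‖ := by
          gcongr
          · exact (hM x hxA).trans (by gcongr; exact le_abs_self M)
          · exact real_inner_le_norm _ _
      _ = |M| * ((r * ‖x - q‖) * ‖x - q‖) + ‖v‖ * ‖w - r • (x - q)‖ := by ring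
      _ ≤ |M| * ((‖w‖ + ε) * ε) + ‖v‖ * ε := by
          gcongr
          rw [norm_sub_rev]
          exact hlt.le
  have hlim : Tendsto (fun ε : ℝ => |M| * ((‖w‖ + ε) * ε) + ‖v‖ * ε) (𝓝[>] 0) (𝓝 0) := by
    have hcont : Continuous fun ε : ℝ => |M| * ((‖w‖ + ε) * ε) + ‖v‖ * ε := by fun_prop
    simpa using (hcont.tendsto 0).mono_left nhdsWithin_le_nhds
  exact ge_of_tendsto hlim (eventually_mem_nhdsWithin.mono hbound)

end NormalCones

section SphericalConvexity

variable {𝒦 : Set (EuclideanSpace ℝ (Fin d))}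

lemma sphHull_eq_hull_inter_sphere (𝒦 : Set (EuclideanSpace ℝ (Fin d))) :
    sphHull 𝒦 = (PointedCone.hull ℝ 𝒦 : Set _) ∩ sphere 0 1 := by
  refine Set.Subset.antisymm (Set.inter_subset_inter_left _ ?_) ?_
  · refine convexHull_min ?_ (PointedCone.hull ℝ 𝒦).convex
    rintro _ ⟨v, hv, c, hc, rfl⟩
    exact (PointedCone.hull ℝ 𝒦).smul_mem hc (PointedCone.subset_hull hv)
  · rintro x ⟨hx, hx1⟩
    refine ⟨?_, hx1⟩
    obtain ⟨n, c, v, rfl⟩ := Submodule.mem_span_set'.1 hx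
    have hn : (n : ℝ) ≠ 0 := by
      rintro hn
      obtain rfl : n = 0 := by exact_mod_cast hn
      simp at hx1
    have hmean : ∑ i, c i • (v i).1 = ∑ i, (n : ℝ)⁻¹ • ((n * c i : ℝ) • (v i).1) := by
      refine Finset.sum_congr rfl fun i _ => ?_
      rw [smul_smul, inv_mul_cancel_left₀ hn]
      rfl
    rw [hmean]
    refine (convex_convexHull ℝ _).sum_mem (fun _ _ => by positivity) (by simp [hn]) fun i _ => ?_
    exact subset_convexHull ℝ _ ⟨v i, (v i).2, n * c i, mul_nonneg n.cast_nonneg (c i).2, rfl⟩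

lemma subset_sphHull (hK : 𝒦 ⊆ sphere 0 1) : 𝒦 ⊆ sphHull 𝒦 :=
  sphHull_eq_hull_inter_sphere 𝒦 ▸ Set.subset_inter PointedCone.subset_hull hK

lemma SphConvex.closure_hull_inter_sphere_subset (h : SphConvex 𝒦) (hclosed : IsClosed 𝒦) :
    closure (PointedCone.hull ℝ 𝒦 : Set _) ∩ sphere 0 1 ⊆ 𝒦 := by
  rintro x ⟨hx, hx1⟩
  have hmem := mem_closure_inter_sphere_of_mem_closure _ hx (mem_sphere_zero_iff_norm.1 hx1)
  rwa [← sphHull_eq_hull_inter_sphere, h, hclosed.closure_eq] at hmem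

-- `v` is the direction of the projection of `y` onto the closed cone generated by `𝒦`.
lemma SphConvex.exists_forall_inner_le_mul (h : SphConvex 𝒦) (hclosed : IsClosed 𝒦)
    {y : EuclideanSpace ℝ (Fin d)} (hy : ∃ v ∈ 𝒦, 0 < ⟪v, y⟫_ℝ) :
    ∃ v ∈ 𝒦, 0 ≤ ⟪v, y⟫_ℝ ∧ ∀ w ∈ 𝒦, ⟪w, y⟫_ℝ ≤ ⟪v, y⟫_ℝ * ⟪w, v⟫_ℝ := by
  let C : ProperCone ℝ (EuclideanSpace ℝ (Fin d)) := Submodule.closure (PointedCone.hull ℝ 𝒦)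
  have hKC : 𝒦 ⊆ C := PointedCone.subset_hull.trans subset_closure
  obtain ⟨p, hpC, horth, hpolar⟩ := exists_moreau_decomposition C y
  have hp0 : p ≠ 0 := by
    rintro rfl
    obtain ⟨v, hv, hvy⟩ := hy
    have := hpolar v (hKC hv)
    rw [sub_zero, real_inner_comm] at this
    exact this.not_gt hvy
  have hyp : ⟪p, y⟫_ℝ = ‖p‖ ^ 2 := by
    rw [real_inner_comm, ← real_inner_self_eq_norm_sq]
    simpa [inner_sub_left, sub_eq_zero] using horth
  refine ⟨‖p‖⁻¹ • p, h.closure_hull_inter_sphere_subset hclosed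
    ⟨C.smul_mem hpC (by positivity), inv_norm_smul_mem_sphere hp0⟩, ?_, fun w hw => ?_⟩
  · rw [real_inner_smul_left, hyp]
    positivity
  have hwy : ⟪w, y⟫_ℝ ≤ ⟪w, p⟫_ℝ := by
    simpa [inner_sub_left, real_inner_comm] using hpolar w (hKC hw)
  rw [real_inner_smul_left, real_inner_smul_right, hyp]
  convert hwy using 1
  have := norm_ne_zero_iff.2 hp0
  field_simp

end SphericalConvexity

section RCone

variable {R : ℝ} {𝒦 𝓛 : Set (EuclideanSpace ℝ (Fin d))} {x y p v : EuclideanSpace ℝ (Fin d)}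

lemma mem_RCone_iff_le_dist : x ∈ RCone R 𝒦 ↔ ∀ v ∈ 𝒦, R ≤ dist x (R • v) := by
  simp [RCone]

lemma mem_RCone_iff_inner_le (hR : 0 ≤ R) (hK : 𝒦 ⊆ sphere 0 1) :
    x ∈ RCone R 𝒦 ↔ ∀ v ∈ 𝒦, 2 * R * ⟪v, x⟫_ℝ ≤ ‖x‖ ^ 2 := by
  rw [mem_RCone_iff_le_dist]
  refine forall₂_congr fun v hv => ?_
  simpa using le_dist_add_smul_iff (x := x) (q := 0) (mem_sphere_zero_iff_norm.1 (hK hv)) hR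

lemma isClosed_RCone (R : ℝ) (𝒦 : Set (EuclideanSpace ℝ (Fin d))) : IsClosed (RCone R 𝒦) :=
  isClosed_biInter fun _ _ => isOpen_ball.isClosed_compl

lemma zero_mem_RCone (R : ℝ) (hK : 𝒦 ⊆ sphere 0 1) : 0 ∈ RCone R 𝒦 :=
  mem_RCone_iff_le_dist.2 fun v hv => by
    rw [dist_zero_left, norm_smul, mem_sphere_zero_iff_norm.1 (hK hv), mul_one]
    exact Real.le_norm_self R

-- For `s` slightly smaller than `2 * R` the point `s • w` lies in the ball about `R • w`, and the
-- other balls that contain it have directions close to `w`.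
lemma subset_of_RCone_subset_RCone (hR : 0 < R) (hclosed : IsClosed 𝒦) (hK : 𝒦 ⊆ sphere 0 1)
    (hL : 𝓛 ⊆ sphere 0 1) (h : RCone R 𝒦 ⊆ RCone R 𝓛) : 𝓛 ⊆ 𝒦 := by
  intro w hw
  have hw1 : ‖w‖ = 1 := mem_sphere_zero_iff_norm.1 (hL hw)
  rw [← hclosed.closure_eq, Metric.mem_closure_iff]
  intro ε hε
  obtain ⟨s, hs, hs2⟩ : ∃ s, max 0 (R * (2 - ε ^ 2)) < s ∧ s < 2 * R :=
    exists_between (max_lt (by positivity) (by nlinarith [sq_pos_of_pos hε]))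
  obtain ⟨hs0, hsε⟩ := max_lt_iff.1 hs
  have hsw : s • w ∉ RCone R 𝒦 := fun hmem => by
    have := (mem_RCone_iff_inner_le hR.le hL).1 (h hmem) w hw
    rw [real_inner_smul_right, real_inner_self_eq_norm_sq, norm_smul, hw1,
      Real.norm_of_nonneg hs0.le] at this
    nlinarith
  rw [mem_RCone_iff_inner_le hR.le hK] at hsw
  push Not at hsw
  obtain ⟨v, hv, hlt⟩ := hsw
  have hv1 : ‖v‖ = 1 := mem_sphere_zero_iff_norm.1 (hK hv)
  rw [real_inner_smul_right, norm_smul, hw1, Real.norm_of_nonneg hs0.le] at hlt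
  refine ⟨v, hv, lt_of_pow_lt_pow_left₀ 2 hε.le ?_⟩
  have hvw : s < 2 * R * ⟪v, w⟫_ℝ := lt_of_mul_lt_mul_left (by linarith) hs0.le
  rw [dist_eq_norm, norm_sub_sq_real, hv1, hw1, real_inner_comm]
  exact lt_of_mul_lt_mul_left (by linarith) hR.le

lemma hull_le_proxNormalCone_RCone (hR : 0 < R) (hK : 𝒦 ⊆ sphere 0 1) :
    PointedCone.hull ℝ 𝒦 ≤ proxNormalCone (RCone R 𝒦) 0 :=
  Submodule.span_le.2 fun v hv =>
    mem_proxNormalCone_of_le_dist (mem_sphere_zero_iff_norm.1 (hK hv)) hR fun x hx => by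
      simpa using mem_RCone_iff_le_dist.1 hx v hv

lemma sphHull_subset_proxNormalCone_RCone (hR : 0 < R) (hK : 𝒦 ⊆ sphere 0 1) :
    sphHull 𝒦 ⊆ proxNormalCone (RCone R 𝒦) 0 :=
  sphHull_eq_hull_inter_sphere 𝒦 ▸
    Set.inter_subset_left.trans (hull_le_proxNormalCone_RCone hR hK)

lemma sphHull_subset_unitNor_RCone (hR : 0 < R) (hK : 𝒦 ⊆ sphere 0 1) :
    sphHull 𝒦 ⊆ unitNor (RCone R 𝒦) 0 :=
  Set.subset_inter
    ((sphHull_subset_proxNormalCone_RCone hR hK).trans proxNormalCone_subset_Nor)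
    Set.inter_subset_right

lemma Nor_RCone_subset_closure_hull (hR : 0 ≤ R) (hK : 𝒦 ⊆ sphere 0 1) :
    Nor (RCone R 𝒦) 0 ⊆ closure (PointedCone.hull ℝ 𝒦 : Set _) := by
  rw [← coe_innerDual_innerDual]
  intro x hx z hz
  have hray : ∀ t : ℝ, 0 < t → 0 + t • -z ∈ RCone R 𝒦 := fun t ht => by
    refine (mem_RCone_iff_inner_le hR hK).2 fun v hv => ?_
    have hvz : 0 ≤ ⟪v, z⟫_ℝ := hz hv
    rw [zero_add, smul_neg, inner_neg_right, real_inner_smul_right]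
    nlinarith [sq_nonneg ‖-(t • z)‖, mul_nonneg hR (mul_nonneg ht.le hvz)]
  have := hx _ (mem_Tan_of_forall_add_smul_mem hray)
  rw [inner_neg_right, neg_nonpos, real_inner_comm] at this
  exact this

lemma SphConvex.unitNor_RCone_eq (h : SphConvex 𝒦) (hR : 0 < R) (hclosed : IsClosed 𝒦)
    (hK : 𝒦 ⊆ sphere 0 1) : unitNor (RCone R 𝒦) 0 = 𝒦 :=
  Set.Subset.antisymm
    ((Set.inter_subset_inter_left _ (Nor_RCone_subset_closure_hull hR.le hK)).trans
      (h.closure_hull_inter_sphere_subset hclosed))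
    ((subset_sphHull hK).trans (sphHull_subset_unitNor_RCone hR hK))

lemma mem_RCone_of_forall_inner_le_mul (hR : 0 ≤ R) (hK : 𝒦 ⊆ sphere 0 1)
    (hv : ‖v‖ = 1) (hvp : 0 ≤ ⟪v, p⟫_ℝ) (hdom : ∀ w ∈ 𝒦, ⟪w, p⟫_ℝ ≤ ⟪v, p⟫_ℝ * ⟪w, v⟫_ℝ)
    (hdist : R ≤ dist p (R • v)) : p ∈ RCone R 𝒦 := by
  refine (mem_RCone_iff_inner_le hR hK).2 fun w hw => ?_
  have hwv : ⟪w, v⟫_ℝ ≤ 1 := by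
    simpa [hv, mem_sphere_zero_iff_norm.1 (hK hw)] using real_inner_le_norm w v
  have hball : 2 * R * ⟪v, p⟫_ℝ ≤ ‖p‖ ^ 2 := by
    simpa using (le_dist_add_smul_iff (x := p) (q := 0) hv hR).1 (by simpa using hdist)
  calc 2 * R * ⟪w, p⟫_ℝ ≤ 2 * R * ⟪v, p⟫_ℝ := by
        gcongr
        exact (hdom w hw).trans (mul_le_of_le_one_right hvp hwv)
    _ ≤ ‖p‖ ^ 2 := hball

lemma exists_mem_RCone_wbtw (hR : 0 < R) (hK : 𝒦 ⊆ sphere 0 1)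
    (hv : ‖v‖ = 1) (hdom : ∀ w ∈ 𝒦, ⟪w, y⟫_ℝ ≤ ⟪v, y⟫_ℝ * ⟪w, v⟫_ℝ)
    (hyball : dist y (R • v) < R) (hyv : y ≠ R • v) :
    ∃ q ∈ RCone R 𝒦, dist (R • v) q = R ∧ Wbtw ℝ (R • v) y q := by
  obtain ⟨s, hsR⟩ : ∃ s, s = R / dist (R • v) y := ⟨_, rfl⟩
  have hdist0 : 0 < dist (R • v) y := dist_pos.2 hyv.symm
  have hs : 1 ≤ s := by
    rw [hsR, one_le_div hdist0, dist_comm]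
    exact hyball.le
  obtain ⟨q, hq⟩ : ∃ q, q = AffineMap.lineMap (R • v) y s := ⟨_, rfl⟩
  have hqdist : dist (R • v) q = R := by
    rw [hq, dist_left_lineMap, Real.norm_of_nonneg (by linarith), hsR,
      div_mul_cancel₀ _ hdist0.ne']
  have hinner : ∀ w, ⟪w, q⟫_ℝ = (1 - s) * (R * ⟪w, v⟫_ℝ) + s * ⟪w, y⟫_ℝ := fun w => by
    rw [hq, AffineMap.lineMap_apply_module, inner_add_right, real_inner_smul_right,
      real_inner_smul_right, real_inner_smul_right]
  have hvq : 0 ≤ ⟪v, q⟫_ℝ := by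
    have := (dist_add_smul_le_iff (x := q) (q := 0) hv hR.le).1 (by simp [dist_comm q, hqdist])
    rw [sub_zero] at this
    exact nonneg_of_mul_nonneg_right ((sq_nonneg _).trans this) (by positivity)
  refine ⟨q, mem_RCone_of_forall_inner_le_mul hR.le hK hv hvq (fun w hw => ?_)
    (dist_comm _ q ▸ hqdist.ge), hqdist,
    wbtw_iff_left_eq_or_right_mem_image_Ici.2 (Or.inr ⟨s, hs, hq.symm⟩)⟩
  rw [hinner w, hinner v, real_inner_self_eq_norm_sq, hv]
  linarith [mul_le_mul_of_nonneg_left (hdom w hw) (zero_le_one.trans hs)]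

lemma SphConvex.mem_Unp_RCone (h : SphConvex 𝒦) (hR : 0 < R) (hclosed : IsClosed 𝒦)
    (hK : 𝒦 ⊆ sphere 0 1) (hy : infDist y (RCone R 𝒦) < R) :
    y ∈ Unp (RCone R 𝒦) := by
  by_cases hyC : y ∈ RCone R 𝒦
  · rw [Unp, Set.mem_ofPred_eq, infDist_zero_of_mem hyC]
    exact ⟨y, ⟨hyC, dist_self y⟩, fun b hb => (dist_eq_zero.1 hb.2).symm⟩
  have hpos : ∃ v ∈ 𝒦, 0 < ⟪v, y⟫_ℝ := by
    rw [mem_RCone_iff_inner_le hR.le hK] at hyC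
    push Not at hyC
    obtain ⟨v, hv, hlt⟩ := hyC
    exact ⟨v, hv, pos_of_mul_pos_right ((sq_nonneg _).trans_lt hlt) (by positivity)⟩
  obtain ⟨v, hv, hvy, hdom⟩ := h.exists_forall_inner_le_mul hclosed hpos
  have hv1 : ‖v‖ = 1 := mem_sphere_zero_iff_norm.1 (hK hv)
  have hyball : dist y (R • v) < R := lt_of_not_ge fun hle =>
    hyC (mem_RCone_of_forall_inner_le_mul hR.le hK hv1 hvy hdom hle)
  have hRCone : ∀ b ∈ RCone R 𝒦, R ≤ dist (R • v) b := fun b hb =>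
    dist_comm b _ ▸ mem_RCone_iff_le_dist.1 hb v hv
  have hyv : y ≠ R • v := by
    rintro rfl
    exact hy.not_ge ((le_infDist ⟨0, zero_mem_RCone R hK⟩).2 hRCone)
  obtain ⟨q, hq, hqdist, hwbtw⟩ := exists_mem_RCone_wbtw hR hK hv1 hdom hyball hyv
  exact existsUnique_nearest_of_wbtw (hqdist.symm ▸ hRCone) hq hwbtw hyv

lemma SphConvex.le_reach_RCone (h : SphConvex 𝒦) (hR : 0 < R) (hclosed : IsClosed 𝒦)
    (hK : 𝒦 ⊆ sphere 0 1) : ENNReal.ofReal R ≤ reach (RCone R 𝒦) :=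
  le_reach_of_forall_infDist_lt hR fun _ => h.mem_Unp_RCone hR hclosed hK

lemma RCone_subset_RCone_sphHull_of_le_reach (hR : 0 < R) (hK : 𝒦 ⊆ sphere 0 1)
    (hreach : ENNReal.ofReal R ≤ reach (RCone R 𝒦)) : RCone R 𝒦 ⊆ RCone R (sphHull 𝒦) := by
  intro x hx
  have h0 : (0 : EuclideanSpace ℝ (Fin d)) ∈ RCone R 𝒦 := zero_mem_RCone R hK
  refine mem_RCone_iff_le_dist.2 fun w hw => ?_
  simpa using le_dist_add_smul_of_mem_proxNormalCone (isClosed_RCone R 𝒦) h0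
    (mem_sphere_zero_iff_norm.1 hw.2) (sphHull_subset_proxNormalCone_RCone hR hK hw) hR
    (ball_subset_Unp_of_le_reach hreach h0) hx

lemma sphConvex_of_RCone_subset (hR : 0 < R) (hclosed : IsClosed 𝒦) (hK : 𝒦 ⊆ sphere 0 1)
    (h : RCone R 𝒦 ⊆ RCone R (sphHull 𝒦)) : SphConvex 𝒦 :=
  Set.Subset.antisymm
    (subset_of_RCone_subset_RCone hR hclosed hK Set.inter_subset_right h) (subset_sphHull hK)

end RCone

end RBody

open RBody in
theorem mainTheorem3_general {d : ℕ} {R : ℝ} (hR : 0 < R) {𝒦 : Set (EuclideanSpace ℝ (Fin d))}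
    (hclosed : IsClosed 𝒦) (hK : 𝒦 ⊆ Metric.sphere 0 1) :
    List.TFAE
      [SphConvex 𝒦,
        ENNReal.ofReal R ≤ reach (RCone R 𝒦),
        RCone R 𝒦 = RCone R (unitNor (RCone R 𝒦) 0)] := by
  tfae_have 1 → 2 := fun hconv => hconv.le_reach_RCone hR hclosed hK
  tfae_have 2 → 1 := fun hreach =>
    sphConvex_of_RCone_subset hR hclosed hK (RCone_subset_RCone_sphHull_of_le_reach hR hK hreach)
  tfae_have 1 → 3 := fun hconv => by rw [hconv.unitNor_RCone_eq hR hclosed hK]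
  tfae_have 3 → 1 := fun heq =>
    sphConvex_of_RCone_subset hR hclosed hK <| heq.subset.trans <|
      Set.biInter_subset_biInter_left (sphHull_subset_unitNor_RCone hR hK)
  tfae_finish

theorem mainTheorem3 {d : ℕ} (R : ℝ) (hR : 0 < R)
    (𝒦 : Set (EuclideanSpace ℝ (Fin d))) (hne : 𝒦.Nonempty) (hclosed : IsClosed 𝒦)
    (hhemi : ∃ u ∈ Metric.sphere (0 : EuclideanSpace ℝ (Fin d)) 1, 𝒦 ⊆ RBody.hemisphere u) :
    List.TFAE
      [RBody.SphConvex 𝒦,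
        ENNReal.ofReal R ≤ RBody.reach (RBody.RCone R 𝒦),
        RBody.RCone R 𝒦 = RBody.RCone R (RBody.unitNor (RBody.RCone R 𝒦) 0)] := by
  obtain ⟨u, -, hu⟩ := hhemi
  exact mainTheorem3_general hR hclosed fun v hv => (hu hv).1
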